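/- Let $n\ge 1$ be an integer and $1<p<\infty$; all functions and distributions are complex valued, and we read $\frac{n}{n-k}=+\infty$ when $n\le k$ ($k=1,2$). Let $W^{\Delta,p}(\mathbb R^n\setminus\{0\})$ be the space of all $u\in L^p(\mathbb R^n\setminus\{0\})$ whose distributional Laplacian $\Delta_{\mathbb R^n\setminus\{0\}}u\in\mathscr D'(\mathbb R^n\setminus\{0\})$ is given by a function in $L^p(\mathbb R^n\setminus\{0\})$. For $f\in L^p(\mathbb R^n\setminus\{0\})$ let $\tilde f\in L^p(\mathbb R^n)$ be its extension by zero. Let $u\in W^{\Delta,p}(\mathbb R^n\setminus\{0\})$ and $v:=\Delta_{\mathbb R^n\setminus\{0\}}u$, and let $\Delta$ be the Laplace operator and $D_j$ the partial derivatives on $\mathscr D'(\mathbb R^n)$, and $\delta_0$ the Dirac distribution at $0$. Then the distribution $-\Delta\tilde u+\tilde v$ on $\mathbb R^n$ has support contained in $\{0\}$, and there are constants $c_0,c_1,\dots,c_n\in\mathbb C$ (those that occur in the case at hand) with $$ -\Delta \tilde u+\tilde v=\begin{cases} c_0\delta_0+\sum_{j=1}^n c_jD_j\delta_0, & \text{if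 } 1<p<\frac n{n-1},\\ c_0\delta_0, & \text{if } \frac n{n-1}\le p<\frac n{n-2},\\ 0, & \text{if } p\ge \frac n{n-2}.\end{cases} $$ The representation is unique: if in the respective case $-\Delta\tilde u+w=d_0\delta_0+\sum_{j=1}^n d_jD_j\delta_0$ (respectively $-\Delta\tilde u+w=d_0\delta_0$, respectively $-\Delta\tilde u+w=0$) for some $w\in L^p(\mathbb R^n)$ and constants $d_j\in\mathbb C$, then $w=\tilde v$ and $d_j=c_j$ for every $j$ that occurs. -/

import Mathlib

open MeasureTheory TopologicalSpace Distributions LineDeriv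
open scoped ENNReal

noncomputable section

namespace LaplaceSobolev

/-- The Euclidean space `ℝⁿ`. -/
abbrev Rn (n : ℕ) : Type := EuclideanSpace ℝ (Fin n)

variable {n : ℕ}

/-- The regular distribution `φ ↦ ∫ φ f` on the open set `Ω` given by a function `f` that is
locally integrable on `Ω`. -/
def regular (Ω : Opens (Rn n)) (f : Rn n → ℂ) : 𝓓'(Ω, ℂ) :=
  ContinuousLinearMap.toUniformConvergenceCLM (RingHom.id ℝ) ℂ _
    (TestFunction.integralAgainstBilinCLM (ContinuousLinearMap.lsmul ℝ ℝ) volume f)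

theorem regular_apply {Ω : Opens (Rn n)} {f : Rn n → ℂ}
    (hf : LocallyIntegrableOn f Ω volume) (φ : 𝓓(Ω, ℝ)) :
    regular Ω f φ = ∫ x, φ x • f x :=
  TestFunction.integralAgainstBilinCLM_eq_integral hf

/-- Elements of `L^p(Ω)`, `p ≥ 1`, are locally integrable on `Ω`. -/
theorem locallyIntegrableOn_Lp (Ω : Opens (Rn n)) {p : ℝ≥0∞} (hp : 1 ≤ p)
    (u : Lp ℂ p (volume.restrict (Ω : Set (Rn n)))) :
    LocallyIntegrableOn u Ω volume :=
  locallyIntegrableOn_of_locallyIntegrable_restrict ((Lp.memLp u).locallyIntegrable hp)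

/-- The distributional Laplace operator `∑ᵢ Dᵢ Dᵢ` on `𝓓'(Ω)`. -/
def laplace (Ω : Opens (Rn n)) (T : 𝓓'(Ω, ℂ)) : 𝓓'(Ω, ℂ) :=
  ∑ i : Fin n, ∂_{EuclideanSpace.single i (1 : ℝ)} (∂_{EuclideanSpace.single i (1 : ℝ)} T)

/-- `Δ_Ω u = v` in `𝓓'(Ω)`, for `u, v ∈ L^p(Ω)`. -/
def LaplaceEq (Ω : Opens (Rn n)) {p : ℝ≥0∞}
    (u v : Lp ℂ p (volume.restrict (Ω : Set (Rn n)))) : Prop :=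
  laplace Ω (regular Ω u) = regular Ω v

/-- The space `W^{Δ,p}(Ω)` of all `u ∈ L^p(Ω)` with `Δ_Ω u ∈ L^p(Ω)`. -/
def WDelta (Ω : Opens (Rn n)) (p : ℝ≥0∞) :
    Set (Lp ℂ p (volume.restrict (Ω : Set (Rn n)))) :=
  {u | ∃ v, LaplaceEq Ω u v}

/-- The extension by zero `L^p(Ω) → L^p(ℝⁿ)`. -/
def zeroExt {Ω : Opens (Rn n)} {p : ℝ≥0∞}
    (u : Lp ℂ p (volume.restrict (Ω : Set (Rn n)))) :
    Lp ℂ p (volume : Measure (Rn n)) :=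
  ((memLp_indicator_iff_restrict Ω.isOpen.measurableSet).2 (Lp.memLp u)).toLp
    ((Ω : Set (Rn n)).indicator u)

variable (n) in
/-- The open set `ℝⁿ ∖ {0}`. -/
def punctured : Opens (Rn n) := ⟨{0}ᶜ, isOpen_compl_singleton⟩

variable (n) in
/-- The complex Dirac distribution `δ₀` on `ℝⁿ`. -/
def dirac : 𝓓'((⊤ : Opens (Rn n)), ℂ) :=
  Distribution.mapCLM Complex.ofRealCLM (Distribution.delta (0 : Rn n))

/-- `Dⱼ δ₀`. -/
def diracD (j : Fin n) : 𝓓'((⊤ : Opens (Rn n)), ℂ) :=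
  ∂_{EuclideanSpace.single j (1 : ℝ)} (dirac n)

/-- The exponent `n / (n - k)`, read as `+∞` when `n ≤ k`. -/
def critExp (n k : ℕ) : ℝ≥0∞ :=
  if n ≤ k then ⊤ else (n : ℝ≥0∞) / ((n - k : ℕ) : ℝ≥0∞)

/-- The distribution `-Δ ũ + w` on `ℝⁿ`, for `u ∈ L^p(ℝⁿ ∖ {0})` and `w ∈ L^p(ℝⁿ)`. -/
def defect {p : ℝ≥0∞} (u : Lp ℂ p (volume.restrict (punctured n : Set (Rn n))))
    (w : Lp ℂ p (volume : Measure (Rn n))) : 𝓓'((⊤ : Opens (Rn n)), ℂ) :=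
  -laplace ⊤ (regular ⊤ (zeroExt u)) + regular ⊤ w

end LaplaceSobolev

end

noncomputable section

namespace LaplaceSobolev

variable {n : ℕ}

/-! Write `T` for `-Δũ + ṽ`. It kills test functions supported off the origin, so `T φ = T (χ(N·)
φ)` for every `N ≥ 1`, with `χ` a cutoff equal to one near `0`. If `φ` vanishes to order `2 - k` at
`0`, then the second derivatives of `χ(N·) φ` are `O(N ^ k)` and live in the ball of radius `2 / N`.
By Hölder their pairing with `ũ` is at most a constant times `N ^ k * N ^ (-n (1 - 1/p))` times the
`L^p` norm of `ũ` on that ball. This norm tends to zero, so `T φ = 0` as soon as `k ≤ n (1 - 1/p)`,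
endpoint included; for `k < n` this says `p ≥ n / (n - k)` (`defect_eq_zero_of_vanishing_order`).

The cases `k = 0, 1, 2` give the three formulas: subtracting a cut-off Taylor polynomial shows that
`T` depends only on the first-order jet of `φ` at `0`, on `φ 0`, or on nothing
(`eq_comb_of_vanishing`). For uniqueness, testing off the origin determines `w`, and `δ₀`, `Dⱼ δ₀`
are linearly independent (`defect_representation_unique`). -/

theorem lineDeriv_apply {Ω : Opens (Rn n)} (φ : 𝓓(Ω, ℝ)) (v x : Rn n) :
    (∂_{v} φ) x = fderiv ℝ φ x v := by
  rw [TestFunction.lineDerivOp_eq_lineDerivCLM (𝕜 := ℝ), TestFunction.lineDerivCLM_eq_fderivCLM]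
  simp

theorem laplace_apply {Ω : Opens (Rn n)} (T : 𝓓'(Ω, ℂ)) (φ : 𝓓(Ω, ℝ)) :
    laplace Ω T φ = ∑ i : Fin n,
      T (∂_{EuclideanSpace.single i (1 : ℝ)} (∂_{EuclideanSpace.single i (1 : ℝ)} φ)) := by
  simp [laplace]

theorem dirac_apply (φ : 𝓓((⊤ : Opens (Rn n)), ℝ)) : dirac n φ = φ 0 := by
  simp [dirac]

theorem diracD_apply (j : Fin n) (φ : 𝓓((⊤ : Opens (Rn n)), ℝ)) :
    diracD j φ = -(fderiv ℝ φ 0 (EuclideanSpace.single j 1) : ℝ) := by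
  simp [diracD, dirac_apply, lineDeriv_apply]

theorem comb_apply (c₀ : ℂ) (c : Fin n → ℂ) (φ : 𝓓((⊤ : Opens (Rn n)), ℝ)) :
    (c₀ • dirac n + ∑ j, c j • diracD j) φ =
      c₀ * φ 0 - ∑ j, c j * (fderiv ℝ φ 0 (EuclideanSpace.single j 1) : ℝ) := by
  simp [dirac_apply, diracD_apply, sub_eq_add_neg]

theorem defect_apply {p : ℝ≥0∞} (u : Lp ℂ p (volume.restrict (punctured n : Set (Rn n))))
    (w : Lp ℂ p (volume : Measure (Rn n))) (φ : 𝓓((⊤ : Opens (Rn n)), ℝ)) :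
    defect u w φ = -(∑ i : Fin n, regular ⊤ (zeroExt u)
      (∂_{EuclideanSpace.single i (1 : ℝ)} (∂_{EuclideanSpace.single i (1 : ℝ)} φ)))
      + regular ⊤ w φ := by
  simp [defect, laplace_apply]

open Filter Topology Metric
open scoped ContDiff

/-! ### Pairings of `L^p` functions with functions concentrating at the origin. -/

section Concentration

/-- Absolute continuity of the integral of `|w|^p`. This decay is what makes the critical exponents
admissible. -/
theorem tendsto_eLpNorm_indicator_closedBall (hn : 1 ≤ n) {p : ℝ≥0∞} (hp : 1 ≤ p) (hp_top : p ≠ ⊤)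
    {w : Rn n → ℂ} (hw : MemLp w p volume) :
    Tendsto (fun N : ℕ => eLpNorm ((closedBall (0 : Rn n) (2 / N)).indicator w) p volume)
      atTop (𝓝 0) := by
  have hvol : Tendsto (fun N : ℕ => volume (closedBall (0 : Rn n) (2 / N))) atTop (𝓝 0) := by
    have h1 : Tendsto (fun N : ℕ => ENNReal.ofReal ((2 / (N : ℝ)) ^ n) * volume (ball (0 : Rn n) 1))
        atTop (𝓝 (ENNReal.ofReal ((0 : ℝ) ^ n) * volume (ball (0 : Rn n) 1))) :=
      ENNReal.Tendsto.mul_const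
        (ENNReal.tendsto_ofReal ((tendsto_const_div_atTop_nhds_zero_nat 2).pow n))
        (Or.inr measure_ball_lt_top.ne)
    rw [zero_pow (by omega), ENNReal.ofReal_zero, zero_mul] at h1
    refine h1.congr fun N => ?_
    rw [Measure.addHaar_closedBall _ _ (by positivity), finrank_euclideanSpace_fin]
  rw [ENNReal.tendsto_nhds_zero]
  intro ε hε
  obtain rfl | hε' := eq_or_ne ε ⊤
  · exact Eventually.of_forall fun _ => le_top
  obtain ⟨δ, hδ, h⟩ := hw.eLpNorm_indicator_le hp hp_top (ENNReal.toReal_pos hε.ne' hε')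
  filter_upwards [ENNReal.tendsto_nhds_zero.1 hvol _ (ENNReal.ofReal_pos.2 hδ)] with N hN
  simpa [ENNReal.ofReal_toReal hε'] using h _ measurableSet_closedBall hN

/-- `N ^ n` times the volume of a ball of radius `2 / N` does not depend on `N`. -/
theorem pow_mul_volume_closedBall_rpow_le {k N : ℕ} (hN : 1 ≤ N) {a : ℝ} (ha : 0 ≤ a)
    (hk : (k : ℝ) ≤ n * a) :
    (N : ℝ≥0∞) ^ k * volume (closedBall (0 : Rn n) (2 / N)) ^ a
      ≤ (ENNReal.ofReal (2 ^ n) * volume (ball (0 : Rn n) 1)) ^ a := by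
  have hN' : (N : ℝ) ≠ 0 := by positivity
  calc (N : ℝ≥0∞) ^ k * volume (closedBall (0 : Rn n) (2 / N)) ^ a
      ≤ ((N : ℝ≥0∞) ^ n) ^ a * volume (closedBall (0 : Rn n) (2 / N)) ^ a := by
        gcongr
        rw [← ENNReal.rpow_natCast, ← ENNReal.rpow_natCast, ← ENNReal.rpow_mul]
        exact ENNReal.rpow_le_rpow_of_exponent_le (by exact_mod_cast hN) hk
    _ = _ := by
        rw [← ENNReal.mul_rpow_of_nonneg _ _ ha, Measure.addHaar_closedBall _ _ (by positivity),
          finrank_euclideanSpace_fin, ← mul_assoc, ← ENNReal.ofReal_natCast,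
          ← ENNReal.ofReal_pow (by positivity), ← ENNReal.ofReal_mul (by positivity), ← mul_pow,
          mul_div_cancel₀ _ hN']

/-- Pairing an `L^p` function with functions of size `N ^ k` on balls of radius `2 / N` tends to
zero as soon as `k ≤ n (1 - 1 / p)`. -/
theorem tendsto_integral_concentrating (hn : 1 ≤ n) {p : ℝ≥0∞} (hp : 1 ≤ p) (hp_top : p ≠ ⊤)
    {k : ℕ} (hk : (k : ℝ) ≤ n * (1 - 1 / p.toReal)) {w : Rn n → ℂ} (hw : MemLp w p volume)
    {C : ℝ} {ψ : ℕ → Rn n → ℝ} (hψ : ∀ N : ℕ, 1 ≤ N → ∀ x, ‖x‖ ≤ 2 / N → ‖ψ N x‖ ≤ C * N ^ k)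
    (hψ0 : ∀ N : ℕ, 1 ≤ N → ∀ x, 2 / N < ‖x‖ → ψ N x = 0) :
    Tendsto (fun N => ∫ x, ψ N x • w x) atTop (𝓝 0) := by
  have hC : 0 ≤ C := by
    have := (norm_nonneg _).trans (hψ 1 le_rfl 0 (by simp))
    simpa using this
  have hq : 1 ≤ p.toReal := by
    rw [← ENNReal.toReal_one]
    exact ENNReal.toReal_mono hp_top hp
  have ha : 0 ≤ 1 - 1 / p.toReal := by
    rw [sub_nonneg, div_le_one (by linarith)]
    exact hq
  set a := 1 - 1 / p.toReal
  set K : ℝ≥0∞ := ENNReal.ofReal C * (ENNReal.ofReal (2 ^ n) * volume (ball (0 : Rn n) 1)) ^ a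
  have hK : K ≠ ⊤ := ENNReal.mul_ne_top ENNReal.ofReal_ne_top
    (ENNReal.rpow_ne_top_of_nonneg ha (ENNReal.mul_ne_top ENNReal.ofReal_ne_top
      measure_ball_lt_top.ne))
  have hlim := ENNReal.Tendsto.const_mul (a := K)
    (tendsto_eLpNorm_indicator_closedBall hn hp hp_top hw) (Or.inr hK)
  rw [mul_zero] at hlim
  rw [tendsto_zero_iff_enorm_tendsto_zero]
  refine tendsto_of_tendsto_of_tendsto_of_le_of_le' tendsto_const_nhds hlim
    (Eventually.of_forall fun _ => zero_le) ?_
  filter_upwards [eventually_ge_atTop 1] with N hN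
  set B := closedBall (0 : Rn n) (2 / N)
  calc ‖∫ x, ψ N x • w x‖ₑ ≤ ∫⁻ x, ‖ψ N x • w x‖ₑ := enorm_integral_le_lintegral_enorm _
    _ ≤ ∫⁻ x, B.indicator (fun x => ENNReal.ofReal (C * N ^ k) * ‖w x‖ₑ) x := by
        refine lintegral_mono fun x => ?_
        by_cases hx : x ∈ B
        · rw [Set.indicator_of_mem hx, enorm_smul]
          gcongr
          rw [← ofReal_norm]
          exact ENNReal.ofReal_le_ofReal (hψ N hN x (by simpa [B] using hx))
        · simp [hψ0 N hN x (by simpa [B] using hx)]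
    _ = ENNReal.ofReal (C * N ^ k) * eLpNorm w 1 (volume.restrict B) := by
        rw [lintegral_indicator measurableSet_closedBall, lintegral_const_mul' _ _
          ENNReal.ofReal_ne_top, eLpNorm_one_eq_lintegral_enorm]
    -- Hölder on the ball: the factor `volume B ^ a` offsets `N ^ k`.
    _ ≤ ENNReal.ofReal (C * N ^ k) * (eLpNorm w p (volume.restrict B) * volume B ^ a) := by
        gcongr
        have := eLpNorm_le_eLpNorm_mul_rpow_measure_univ hp (hw.1.restrict (s := B))
        simpa [a] using this
    _ = ENNReal.ofReal C * ((N : ℝ≥0∞) ^ k * volume B ^ a) * eLpNorm (B.indicator w) p volume := by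
        rw [eLpNorm_indicator_eq_eLpNorm_restrict measurableSet_closedBall,
          ENNReal.ofReal_mul hC, ENNReal.ofReal_pow (by positivity), ENNReal.ofReal_natCast]
        ring
    _ ≤ K * eLpNorm (B.indicator w) p volume := by
        gcongr
        exact mul_le_mul_right (pow_mul_volume_closedBall_rpow_le hN ha hk) _

end Concentration

/-! ### Second derivatives of products and dilations; bounds from vanishing at the origin. -/

section Calculus

theorem contDiff_fderiv_apply {f : Rn n → ℝ} (hf : ContDiff ℝ ∞ f) (e : Rn n) :
    ContDiff ℝ ∞ fun x => fderiv ℝ f x e :=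
  (hf.fderiv_right (m := ∞) le_rfl).clm_apply contDiff_const

theorem fderiv_fderiv_mul {f g : Rn n → ℝ} (hf : ContDiff ℝ ∞ f) (hg : ContDiff ℝ ∞ g)
    (x e : Rn n) :
    fderiv ℝ (fun y => fderiv ℝ (fun z => f z * g z) y e) x e =
      f x * fderiv ℝ (fun y => fderiv ℝ g y e) x e
        + 2 * (fderiv ℝ f x e * fderiv ℝ g x e)
        + fderiv ℝ (fun y => fderiv ℝ f y e) x e * g x := by
  have hd {h : Rn n → ℝ} (hh : ContDiff ℝ ∞ h) : Differentiable ℝ h :=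
    hh.differentiable (by simp)
  have h1 : (fun y => fderiv ℝ (fun z => f z * g z) y e)
      = fun y => f y * fderiv ℝ g y e + g y * fderiv ℝ f y e := by
    funext y
    rw [fderiv_fun_mul (hd hf y) (hd hg y)]
    simp
  have hf' := hd (contDiff_fderiv_apply hf e)
  have hg' := hd (contDiff_fderiv_apply hg e)
  rw [h1, fderiv_fun_add ((hd hf x).fun_mul (hg' x)) ((hd hg x).fun_mul (hf' x)),
    fderiv_fun_mul (hd hf x) (hg' x), fderiv_fun_mul (hd hg x) (hf' x)]
  simp only [add_apply, smul_apply, smul_eq_mul]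
  ring

theorem fderiv_comp_smul_apply (f : Rn n → ℝ) (c : ℝ) (x e : Rn n) :
    fderiv ℝ (fun y => f (c • y)) x e = c * fderiv ℝ f (c • x) e := by
  rw [fderiv_comp_smul]; simp

theorem fderiv_fderiv_comp_smul {f : Rn n → ℝ} (hf : ContDiff ℝ ∞ f) (c : ℝ) (x e : Rn n) :
    fderiv ℝ (fun y => fderiv ℝ (fun z => f (c • z)) y e) x e
      = c ^ 2 * fderiv ℝ (fun y => fderiv ℝ f y e) (c • x) e := by
  simp_rw [fderiv_comp_smul_apply]
  rw [fderiv_const_mul, smul_apply, fderiv_comp_smul_apply (fun y => fderiv ℝ f y e), smul_eq_mul]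
  · ring
  · exact ((contDiff_fderiv_apply hf e).comp (contDiff_const_smul c)).differentiable (by simp) x

theorem exists_bound_norm_of_eq_zero {F : Type*} [NormedAddCommGroup F] [NormedSpace ℝ F]
    {f : Rn n → F} (hf : ContDiff ℝ 1 f) (hs : HasCompactSupport f) (h0 : f 0 = 0) :
    ∃ A, ∀ x, ‖f x‖ ≤ A * ‖x‖ := by
  obtain ⟨A, hA⟩ := (hs.fderiv ℝ).exists_bound_of_continuous (hf.continuous_fderiv (by simp))
  refine ⟨A, fun x => ?_⟩
  simpa [h0] using convex_univ.norm_image_sub_le_of_norm_fderiv_le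
    (fun y _ => hf.differentiable (by simp) y) (fun y _ => hA y) (Set.mem_univ 0) (Set.mem_univ x)

/-- The mean value inequality twice: first for the derivative, then for `f` on the ball of radius
`‖x‖`. -/
theorem exists_bound_norm_sq_of_eq_zero {f : Rn n → ℝ} (hf : ContDiff ℝ ∞ f)
    (hs : HasCompactSupport f) (h0 : f 0 = 0) (h1 : fderiv ℝ f 0 = 0) :
    ∃ A, (∀ x, ‖f x‖ ≤ A * ‖x‖ ^ 2) ∧ ∀ x, ‖fderiv ℝ f x‖ ≤ A * ‖x‖ := by
  obtain ⟨A, hA⟩ := exists_bound_norm_of_eq_zero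
    ((hf.fderiv_right (m := ∞) le_rfl).of_le (by exact_mod_cast le_top)) (hs.fderiv ℝ) h1
  refine ⟨max A 0, fun x => ?_, fun x => (hA x).trans (by gcongr; exact le_max_left _ _)⟩
  have := (convex_closedBall (0 : Rn n) ‖x‖).norm_image_sub_le_of_norm_fderiv_le (f := f) (𝕜 := ℝ)
    (C := max A 0 * ‖x‖)
    (fun y _ => hf.differentiable (by simp) y)
    (fun y hy => (hA y).trans (mul_le_mul (le_max_left _ _) (by simpa using hy) (norm_nonneg _)
      (le_max_right _ _))) (x := 0) (y := x) (by simp) (by simp)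
  simpa [h0, sq, mul_assoc] using this

/-- Truncated subtraction is intended: once no vanishing is assumed the exponent is `0`, and compact
support gives the bound. -/
theorem exists_bound_of_vanishing_order {f : Rn n → ℝ} (hf : ContDiff ℝ ∞ f)
    (hs : HasCompactSupport f) {k : ℕ} (h0 : k ≤ 1 → f 0 = 0) (h1 : k = 0 → fderiv ℝ f 0 = 0) :
    ∃ A, 0 ≤ A ∧ (∀ x, ‖f x‖ ≤ A * ‖x‖ ^ (2 - k)) ∧ ∀ x, ‖fderiv ℝ f x‖ ≤ A * ‖x‖ ^ (1 - k) := by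
  obtain ⟨A₀, hA₀⟩ := hs.exists_bound_of_continuous hf.continuous
  obtain ⟨A₁, hA₁⟩ := (hs.fderiv ℝ).exists_bound_of_continuous (hf.continuous_fderiv (by simp))
  have p₀ := (norm_nonneg _).trans (hA₀ 0)
  have p₁ := (norm_nonneg _).trans (hA₁ 0)
  match k, h0, h1 with
  | 0, h0, h1 =>
    obtain ⟨A, hA, hA'⟩ := exists_bound_norm_sq_of_eq_zero hf hs (h0 zero_le_one) (h1 rfl)
    refine ⟨|A|, abs_nonneg A, fun x => (hA x).trans ?_, fun x => (hA' x).trans ?_⟩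
    · gcongr; exact le_abs_self A
    · simp only [tsub_zero, pow_one]; gcongr; exact le_abs_self A
  | 1, h0, _ =>
    obtain ⟨A, hA⟩ := exists_bound_norm_of_eq_zero (hf.of_le (by exact_mod_cast le_top)) hs
      (h0 le_rfl)
    refine ⟨|A| + A₁, by positivity, fun x => (hA x).trans ?_, fun x => (hA₁ x).trans ?_⟩
    · simp only [Nat.add_one_sub_one, pow_one]; gcongr; linarith [le_abs_self A]
    · simp
  | k + 2, _, _ =>
    refine ⟨A₀ + A₁, by positivity, fun x => (hA₀ x).trans ?_, fun x => (hA₁ x).trans ?_⟩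
    · simp [p₁]
    · simp [p₀, show 1 - (k + 2) = 0 by omega]

end Calculus

/-! ### Cutting test functions off at scale `1 / N`. -/

section Cutoff

/-- The product of a smooth function and a test function. -/
def mulTest {Ω : Opens (Rn n)} (g : Rn n → ℝ) (hg : ContDiff ℝ ∞ g) (φ : 𝓓(Ω, ℝ)) : 𝓓(Ω, ℝ) :=
  ⟨fun x => g x * φ x, hg.mul φ.contDiff, φ.hasCompactSupport.mul_left,
    (tsupport_mul_subset_right (f := g)).trans φ.tsupport_subset⟩

theorem mulTest_apply {Ω : Opens (Rn n)} (g : Rn n → ℝ) (hg : ContDiff ℝ ∞ g) (φ : 𝓓(Ω, ℝ))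
    (x : Rn n) : mulTest g hg φ x = g x * φ x := rfl

variable (n) in
/-- A smooth bump function equal to one on the unit ball and supported in the ball of radius 2. -/
def bump : ContDiffBump (0 : Rn n) := ⟨1, 2, one_pos, one_lt_two⟩

theorem bump_contDiff : ContDiff ℝ ∞ (bump n) := (bump n).contDiff

theorem bump_eq_one {x : Rn n} (hx : ‖x‖ ≤ 1) : bump n x = 1 :=
  (bump n).one_of_mem_closedBall (by simpa [bump] using hx)

theorem tsupport_bump : tsupport (bump n) = closedBall 0 2 := (bump n).tsupport_eq

/-- The product of a test function with the bump function at scale `1 / N`. -/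
def shrink (N : ℕ) (φ : 𝓓((⊤ : Opens (Rn n)), ℝ)) : 𝓓((⊤ : Opens (Rn n)), ℝ) :=
  mulTest (fun x => bump n ((N : ℝ) • x)) (bump_contDiff.comp (contDiff_const_smul (N : ℝ))) φ

theorem shrink_apply (N : ℕ) (φ : 𝓓((⊤ : Opens (Rn n)), ℝ)) (x : Rn n) :
    shrink N φ x = bump n ((N : ℝ) • x) * φ x := rfl

theorem smul_notMem_tsupport_bump {N : ℕ} (hN : 1 ≤ N) {x : Rn n} (hx : 2 / (N : ℝ) < ‖x‖) :
    (N : ℝ) • x ∉ tsupport (bump n) := by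
  have : (0 : ℝ) < N := by exact_mod_cast hN
  rw [div_lt_iff₀ this] at hx
  rw [mul_comm] at hx
  simpa [tsupport_bump, norm_smul] using hx

theorem lineDeriv_lineDeriv_apply {Ω : Opens (Rn n)} (φ : 𝓓(Ω, ℝ)) (e x : Rn n) :
    (∂_{e} (∂_{e} φ)) x = fderiv ℝ (fun y => fderiv ℝ φ y e) x e := by
  rw [lineDeriv_apply]
  congr 2

theorem lineDeriv_lineDeriv_shrink (N : ℕ) (φ : 𝓓((⊤ : Opens (Rn n)), ℝ)) (e x : Rn n) :
    (∂_{e} (∂_{e} (shrink N φ))) x =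
      bump n ((N : ℝ) • x) * (∂_{e} (∂_{e} φ)) x
      + 2 * (N * fderiv ℝ (bump n) ((N : ℝ) • x) e * fderiv ℝ φ x e)
      + N ^ 2 * fderiv ℝ (fun y => fderiv ℝ (bump n) y e) ((N : ℝ) • x) e * φ x := by
  rw [lineDeriv_lineDeriv_apply, lineDeriv_lineDeriv_apply, ← fderiv_fderiv_comp_smul bump_contDiff,
    ← fderiv_comp_smul_apply]
  exact fderiv_fderiv_mul (bump_contDiff.comp (contDiff_const_smul (N : ℝ))) φ.contDiff x e

theorem shrink_eq_zero {N : ℕ} (hN : 1 ≤ N) (φ : 𝓓((⊤ : Opens (Rn n)), ℝ)) {x : Rn n}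
    (hx : 2 / (N : ℝ) < ‖x‖) : shrink N φ x = 0 := by
  rw [shrink_apply, image_eq_zero_of_notMem_tsupport (smul_notMem_tsupport_bump hN hx), zero_mul]

theorem lineDeriv_lineDeriv_shrink_eq_zero {N : ℕ} (hN : 1 ≤ N) (φ : 𝓓((⊤ : Opens (Rn n)), ℝ))
    (e : Rn n) {x : Rn n} (hx : 2 / (N : ℝ) < ‖x‖) : (∂_{e} (∂_{e} (shrink N φ))) x = 0 := by
  have h := smul_notMem_tsupport_bump hN hx
  have h1 := fun hm => h (tsupport_fderiv_apply_subset ℝ e hm)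
  have h2 := fun hm => h1 (tsupport_fderiv_apply_subset ℝ e hm)
  have e1 := image_eq_zero_of_notMem_tsupport h1
  have e2 := image_eq_zero_of_notMem_tsupport h2
  rw [lineDeriv_lineDeriv_shrink, image_eq_zero_of_notMem_tsupport h, e1, e2]
  simp

/-- Balances the Leibniz terms: `j` derivatives on the cutoff cost `N ^ j`, while the remaining
factor is `O(r ^ (j - k))`. Each power of `r` pays for one `N` up to a factor `2`, whence `4 = 2 ^
2`. -/
theorem pow_mul_pow_sub_le {N : ℕ} (hN : 1 ≤ N) {k j : ℕ} (hj : j ≤ 2) (hk : k ≤ 2) {r : ℝ}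
    (hr : 0 ≤ r) (hr' : r ≤ 2 / N) : (N : ℝ) ^ j * r ^ (j - k) ≤ 4 * N ^ k := by
  have hN' : (1 : ℝ) ≤ N := by exact_mod_cast hN
  rcases le_total j k with h | h
  · rw [Nat.sub_eq_zero_of_le h, pow_zero, mul_one]
    have := pow_le_pow_right₀ hN' h
    nlinarith [pow_nonneg (zero_le_one.trans hN') k]
  · obtain ⟨m, rfl⟩ := Nat.exists_eq_add_of_le h
    have hm : (N * r) ^ m ≤ 4 := by
      have h2 : N * r ≤ 2 := by rwa [mul_comm, ← le_div_iff₀ (by linarith)]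
      calc (N * r) ^ m ≤ 2 ^ m := by gcongr
        _ ≤ 2 ^ 2 := pow_le_pow_right₀ one_le_two (by omega)
        _ = 4 := by norm_num
    rw [Nat.add_sub_cancel_left, pow_add, mul_assoc, ← mul_pow, mul_comm]
    gcongr

theorem exists_bound_shrink (φ : 𝓓((⊤ : Opens (Rn n)), ℝ)) (e : Rn n) {k : ℕ} (hk : k ≤ 2)
    (h0 : k ≤ 1 → φ 0 = 0) (h1 : k = 0 → fderiv ℝ φ 0 = 0) :
    ∃ C : ℝ, ∀ N : ℕ, 1 ≤ N → ∀ x, ‖x‖ ≤ 2 / N →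
      ‖(∂_{e} (∂_{e} (shrink N φ))) x‖ ≤ C * N ^ k := by
  obtain ⟨A, hA, hA0, hA1⟩ :=
    exists_bound_of_vanishing_order φ.contDiff φ.hasCompactSupport h0 h1
  obtain ⟨D, hD⟩ := (∂_{e} (∂_{e} φ)).hasCompactSupport.exists_bound_of_continuous
    (∂_{e} (∂_{e} φ)).continuous
  obtain ⟨M₁, hM₁⟩ := ((bump n).hasCompactSupport.fderiv_apply (𝕜 := ℝ) e).exists_bound_of_continuous
    (contDiff_fderiv_apply bump_contDiff e).continuous
  obtain ⟨M₂, hM₂⟩ := (((bump n).hasCompactSupport.fderiv_apply (𝕜 := ℝ) e).fderiv_apply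
    (𝕜 := ℝ) e).exists_bound_of_continuous
    (contDiff_fderiv_apply (contDiff_fderiv_apply bump_contDiff e) e).continuous
  have pM₁ := (norm_nonneg _).trans (hM₁ 0)
  have pM₂ := (norm_nonneg _).trans (hM₂ 0)
  have pD := (norm_nonneg _).trans (hD 0)
  -- One summand for each Leibniz term, with `0`, `1` and `2` derivatives on the cutoff.
  refine ⟨D + 2 * (M₁ * (A * ‖e‖) * 4) + M₂ * A * 4, fun N hN x hx => ?_⟩
  have hNk : (1 : ℝ) ≤ N ^ k := one_le_pow₀ (by exact_mod_cast hN)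
  rw [lineDeriv_lineDeriv_shrink]
  refine (norm_add₃_le).trans ?_
  simp only [norm_mul, norm_pow, Real.norm_natCast, Real.norm_ofNat]
  have t0 : ‖bump n ((N : ℝ) • x)‖ * ‖(∂_{e} (∂_{e} φ)) x‖ ≤ D * N ^ k := by
    have : ‖bump n ((N : ℝ) • x)‖ ≤ 1 := by
      rw [Real.norm_of_nonneg (bump n).nonneg]; exact (bump n).le_one
    calc _ ≤ 1 * D := mul_le_mul this (hD x) (norm_nonneg _) zero_le_one
      _ = D * 1 := by ring
      _ ≤ D * N ^ k := by gcongr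
  have t1 : N * ‖fderiv ℝ (bump n) ((N : ℝ) • x) e‖ * ‖fderiv ℝ φ x e‖
      ≤ M₁ * (A * ‖e‖) * 4 * N ^ k := by
    calc _ ≤ N * M₁ * (A * ‖x‖ ^ (1 - k) * ‖e‖) := by
          gcongr
          · exact hM₁ _
          · exact (ContinuousLinearMap.le_opNorm _ _).trans (by gcongr; exact hA1 x)
      _ = M₁ * (A * ‖e‖) * ((N : ℝ) ^ 1 * ‖x‖ ^ (1 - k)) := by ring
      _ ≤ M₁ * (A * ‖e‖) * (4 * N ^ k) := by
          exact mul_le_mul_of_nonneg_left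
            (pow_mul_pow_sub_le hN one_le_two hk (norm_nonneg _) hx) (by positivity)
      _ = _ := by ring
  have t2 : (N : ℝ) ^ 2 * ‖fderiv ℝ (fun y => fderiv ℝ (bump n) y e) ((N : ℝ) • x) e‖ * ‖φ x‖
      ≤ M₂ * A * 4 * N ^ k := by
    calc _ ≤ (N : ℝ) ^ 2 * M₂ * (A * ‖x‖ ^ (2 - k)) := by
          gcongr
          · exact hM₂ _
          · exact hA0 x
      _ = M₂ * A * ((N : ℝ) ^ 2 * ‖x‖ ^ (2 - k)) := by ring
      _ ≤ M₂ * A * (4 * N ^ k) := by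
          exact mul_le_mul_of_nonneg_left
            (pow_mul_pow_sub_le hN le_rfl hk (norm_nonneg _) hx) (by positivity)
      _ = _ := by ring
  linarith

theorem exists_bound_shrink_self (φ : 𝓓((⊤ : Opens (Rn n)), ℝ)) :
    ∃ C : ℝ, ∀ N : ℕ, ∀ x, ‖shrink N φ x‖ ≤ C := by
  obtain ⟨D, hD⟩ := φ.hasCompactSupport.exists_bound_of_continuous φ.continuous
  refine ⟨D, fun N x => ?_⟩
  rw [shrink_apply, norm_mul, Real.norm_of_nonneg (bump n).nonneg]
  exact (mul_le_of_le_one_left (norm_nonneg _) (bump n).le_one).trans (hD x)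

theorem tsupport_sub_shrink_subset (N : ℕ) (φ : 𝓓((⊤ : Opens (Rn n)), ℝ)) :
    tsupport (φ - shrink N φ) ⊆ {(0 : Rn n)}ᶜ := by
  rw [Set.subset_compl_singleton_iff, notMem_tsupport_iff_eventuallyEq]
  have : ∀ᶠ x in 𝓝 (0 : Rn n), ‖(N : ℝ) • x‖ < 1 :=
    (continuous_const_smul (N : ℝ)).norm.continuousAt.eventually_lt continuousAt_const (by simp)
  filter_upwards [this] with x hx
  simp [shrink_apply, bump_eq_one hx.le]

end Cutoff

/-! ### The defect depends only on the behaviour of test functions at the origin. -/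

section Defect

theorem regular_Lp_apply {p : ℝ≥0∞} (hp : 1 ≤ p) (w : Lp ℂ p (volume : Measure (Rn n)))
    (φ : 𝓓((⊤ : Opens (Rn n)), ℝ)) : regular ⊤ w φ = ∫ x, φ x • w x :=
  regular_apply (((Lp.memLp w).locallyIntegrable hp).locallyIntegrableOn _) φ

theorem nontrivial_Rn (hn : 1 ≤ n) : Nontrivial (Rn n) :=
  Module.nontrivial_of_finrank_pos (R := ℝ) (by simpa using Nat.lt_of_lt_of_le Nat.zero_lt_one hn)

theorem zeroExt_ae_eq (hn : 1 ≤ n) {p : ℝ≥0∞}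
    (u : Lp ℂ p (volume.restrict (punctured n : Set (Rn n)))) :
    zeroExt u =ᵐ[volume] u := by
  have := nontrivial_Rn hn
  refine (MemLp.coeFn_toLp _).trans ?_
  filter_upwards [compl_mem_ae_iff.2 (measure_singleton (μ := volume) (0 : Rn n))] with x hx
  exact Set.indicator_of_mem (show x ∈ (punctured n : Set (Rn n)) from hx) _

theorem regular_zeroExt_apply (hn : 1 ≤ n) {p : ℝ≥0∞} (hp : 1 ≤ p)
    (u : Lp ℂ p (volume.restrict (punctured n : Set (Rn n)))) (φ : 𝓓((⊤ : Opens (Rn n)), ℝ))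
    (ψ : 𝓓(punctured n, ℝ)) (h : (φ : Rn n → ℝ) = ψ) :
    regular ⊤ (zeroExt u) φ = regular (punctured n) u ψ := by
  rw [regular_Lp_apply hp, regular_apply (locallyIntegrableOn_Lp _ hp u), h]
  refine integral_congr_ae ?_
  filter_upwards [zeroExt_ae_eq hn u] with x hx
  rw [hx]

variable {p : ℝ≥0∞} {u v : Lp ℂ p (volume.restrict (punctured n : Set (Rn n)))}

/-- Such a `φ` is itself a test function on the punctured space, and the origin is a null set, so
`Δu = v` applies. -/
theorem defect_eq_zero_of_tsupport (hn : 1 ≤ n) (hp : 1 ≤ p) (hv : LaplaceEq (punctured n) u v)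
    (φ : 𝓓((⊤ : Opens (Rn n)), ℝ)) (hφ : tsupport φ ⊆ {(0 : Rn n)}ᶜ) :
    defect u (zeroExt v) φ = 0 := by
  let ψ : 𝓓(punctured n, ℝ) := ⟨φ, φ.contDiff, φ.hasCompactSupport, hφ⟩
  have h := DFunLike.congr_fun hv ψ
  rw [laplace_apply] at h
  rw [defect_apply, regular_zeroExt_apply hn hp v φ ψ rfl, ← h, neg_add_eq_zero]
  refine Finset.sum_congr rfl fun i _ => regular_zeroExt_apply hn hp u _ _ ?_
  funext x
  rw [lineDeriv_lineDeriv_apply, lineDeriv_lineDeriv_apply]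
  rfl

theorem defect_shrink (hn : 1 ≤ n) (hp : 1 ≤ p) (hv : LaplaceEq (punctured n) u v)
    (N : ℕ) (φ : 𝓓((⊤ : Opens (Rn n)), ℝ)) :
    defect u (zeroExt v) (shrink N φ) = defect u (zeroExt v) φ := by
  have := defect_eq_zero_of_tsupport hn hp hv _ (tsupport_sub_shrink_subset N φ)
  rw [map_sub, sub_eq_zero] at this
  exact this.symm

/-- The defect annihilates test functions that vanish to order `2 - k` at the origin. -/
theorem defect_eq_zero_of_vanishing_order (hn : 1 ≤ n) (hp : 1 ≤ p) (hp_top : p ≠ ⊤)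
    (hv : LaplaceEq (punctured n) u v) {k : ℕ} (hk : k ≤ 2)
    (hkp : (k : ℝ) ≤ n * (1 - 1 / p.toReal)) (φ : 𝓓((⊤ : Opens (Rn n)), ℝ))
    (h0 : k ≤ 1 → φ 0 = 0) (h1 : k = 0 → fderiv ℝ φ 0 = 0) :
    defect u (zeroExt v) φ = 0 := by
  have hconst : Tendsto (fun N => defect u (zeroExt v) (shrink N φ)) atTop
      (𝓝 (defect u (zeroExt v) φ)) := by
    simp only [defect_shrink hn hp hv, tendsto_const_nhds_iff]
  refine tendsto_nhds_unique hconst ?_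
  simp only [defect_apply, regular_Lp_apply hp]
  have hu : ∀ i : Fin n, Tendsto (fun N : ℕ => ∫ x, (∂_{EuclideanSpace.single i (1 : ℝ)}
      (∂_{EuclideanSpace.single i (1 : ℝ)} (shrink N φ))) x • zeroExt u x) atTop (𝓝 0) := by
    intro i
    obtain ⟨C, hC⟩ := exists_bound_shrink φ (EuclideanSpace.single i (1 : ℝ)) hk h0 h1
    exact tendsto_integral_concentrating hn hp hp_top hkp (Lp.memLp (zeroExt u)) hC
      fun _ hN _ hx => lineDeriv_lineDeriv_shrink_eq_zero hN φ _ hx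
  have hv' : Tendsto (fun N : ℕ => ∫ x, shrink N φ x • zeroExt v x) atTop (𝓝 0) := by
    -- No derivative falls on the cutoff here, so boundedness suffices and the exponent is `0`.
    obtain ⟨C, hC⟩ := exists_bound_shrink_self φ
    refine tendsto_integral_concentrating hn hp hp_top (k := 0) (C := C) ?_
      (Lp.memLp (zeroExt v)) (fun N _ x _ => by simpa using hC N x)
      fun N hN x hx => shrink_eq_zero hN φ hx
    exact (Nat.cast_le.2 (Nat.zero_le k)).trans hkp
  simpa using (tendsto_finsetSum Finset.univ fun i _ => hu i).neg.add hv'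

end Defect

/-! ### Taylor expansion at the origin, uniqueness, and the critical exponents. -/

section Representation

variable (n) in
/-- The bump function as a test function. -/
def bumpTest : 𝓓((⊤ : Opens (Rn n)), ℝ) :=
  ⟨bump n, (bump n).contDiff, (bump n).hasCompactSupport, by simp⟩

/-- A test function that equals the `j`-th coordinate near the origin. -/
def coordTest (j : Fin n) : 𝓓((⊤ : Opens (Rn n)), ℝ) :=
  mulTest (EuclideanSpace.proj j : Rn n →L[ℝ] ℝ) (ContinuousLinearMap.contDiff _) (bumpTest n)

theorem bumpTest_eventuallyEq : (bumpTest n : Rn n → ℝ) =ᶠ[𝓝 0] fun _ => 1 := by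
  filter_upwards [closedBall_mem_nhds (0 : Rn n) one_pos] with x hx
  exact bump_eq_one (by simpa using hx)

theorem coordTest_eventuallyEq (j : Fin n) :
    (coordTest j : Rn n → ℝ) =ᶠ[𝓝 0] (EuclideanSpace.proj j : Rn n →L[ℝ] ℝ) := by
  filter_upwards [bumpTest_eventuallyEq] with x hx
  simp [coordTest, mulTest_apply, hx]

theorem bumpTest_zero : bumpTest n 0 = 1 := bumpTest_eventuallyEq.eq_of_nhds

theorem coordTest_zero (j : Fin n) : coordTest j 0 = 0 := by
  simpa using (coordTest_eventuallyEq j).eq_of_nhds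

theorem fderiv_bumpTest : fderiv ℝ (bumpTest n) 0 = 0 := by
  rw [bumpTest_eventuallyEq.fderiv_eq]; simp

theorem fderiv_coordTest (j : Fin n) :
    fderiv ℝ (coordTest j) 0 = (EuclideanSpace.proj j : Rn n →L[ℝ] ℝ) := by
  rw [(coordTest_eventuallyEq j).fderiv_eq, ContinuousLinearMap.fderiv]

/-- The first order Taylor polynomial at the origin, cut off to a test function. -/
def taylorTest (φ : 𝓓((⊤ : Opens (Rn n)), ℝ)) : 𝓓((⊤ : Opens (Rn n)), ℝ) :=
  φ 0 • bumpTest n + ∑ j, fderiv ℝ φ 0 (EuclideanSpace.single j 1) • coordTest j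

theorem sub_taylorTest_zero (φ : 𝓓((⊤ : Opens (Rn n)), ℝ)) : (φ - taylorTest φ) 0 = 0 := by
  simp [taylorTest, bumpTest_zero, coordTest_zero]

theorem fderiv_sub_taylorTest (φ : 𝓓((⊤ : Opens (Rn n)), ℝ)) :
    fderiv ℝ (φ - taylorTest φ : 𝓓((⊤ : Opens (Rn n)), ℝ)) 0 = 0 := by
  have key : ∀ e : Rn n, fderiv ℝ (φ - taylorTest φ : 𝓓((⊤ : Opens (Rn n)), ℝ)) 0 e
      = fderiv ℝ φ 0 e - ∑ j, fderiv ℝ φ 0 (EuclideanSpace.single j 1) * e j := by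
    intro e
    have hB : (∂_{e} (bumpTest n)) 0 = 0 := by simp [lineDeriv_apply, fderiv_bumpTest]
    have hC : ∀ j, (∂_{e} (coordTest j)) 0 = e j := by
      intro j; simp [lineDeriv_apply, fderiv_coordTest]
    rw [← lineDeriv_apply, sub_eq_add_neg, lineDerivOp_add, lineDerivOp_neg, taylorTest,
      lineDerivOp_add, lineDerivOp_smul, lineDerivOp_sum]
    simp [lineDerivOp_smul, hB, hC, lineDeriv_apply, sub_eq_add_neg]
  ext e
  rw [key]
  have he : e = ∑ j, e j • EuclideanSpace.single j (1 : ℝ) := by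
    simpa using ((EuclideanSpace.basisFun (Fin n) ℝ).sum_repr e).symm
  conv_lhs => enter [1]; rw [he]
  simp [mul_comm]

/-- `T` takes the same value on `φ` and on its cut-off Taylor polynomial. The minus sign comes from
`Dⱼ δ₀ φ = -∂ⱼ φ(0)`. -/
theorem eq_comb_of_vanishing {T : 𝓓'((⊤ : Opens (Rn n)), ℂ)}
    (hT : ∀ φ : 𝓓((⊤ : Opens (Rn n)), ℝ), φ 0 = 0 → fderiv ℝ φ 0 = 0 → T φ = 0) :
    T = T (bumpTest n) • dirac n + ∑ j, (-T (coordTest j)) • diracD j := by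
  ext φ
  have h := hT _ (sub_taylorTest_zero φ) (fderiv_sub_taylorTest φ)
  rw [map_sub, sub_eq_zero] at h
  rw [comb_apply, h, taylorTest]
  simp [mul_comm]

theorem smul_dirac_eq_comb (c₀ : ℂ) :
    c₀ • dirac n = c₀ • dirac n + ∑ j, (0 : Fin n → ℂ) j • diracD j := by
  ext φ
  rw [comb_apply]
  simp [dirac_apply]

theorem eq_smul_dirac_of_vanishing {T : 𝓓'((⊤ : Opens (Rn n)), ℂ)}
    (hT : ∀ φ : 𝓓((⊤ : Opens (Rn n)), ℝ), φ 0 = 0 → T φ = 0) :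
    T = T (bumpTest n) • dirac n := by
  refine (eq_comb_of_vanishing fun φ h _ => hT φ h).trans
    (Eq.trans ?_ (smul_dirac_eq_comb _).symm)
  simp only [hT _ (coordTest_zero _), neg_zero, Pi.zero_apply]

/-- The fundamental lemma of the calculus of variations off the origin, which is a null set. -/
theorem ae_eq_of_regular_eq_off_zero (hn : 1 ≤ n) {p : ℝ≥0∞} (hp : 1 ≤ p)
    {w w' : Lp ℂ p (volume : Measure (Rn n))}
    (h : ∀ φ : 𝓓((⊤ : Opens (Rn n)), ℝ), tsupport φ ⊆ {(0 : Rn n)}ᶜ →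
      regular ⊤ w φ = regular ⊤ w' φ) : w = w' := by
  have := nontrivial_Rn hn
  rw [← sub_eq_zero]
  refine Lp.ext ?_
  have hae := isOpen_compl_singleton.ae_eq_zero_of_integral_contDiff_smul_eq_zero
    (f := (w - w' : Lp ℂ p (volume : Measure (Rn n)))) (U := {(0 : Rn n)}ᶜ) (μ := volume)
    (((Lp.memLp (w - w')).locallyIntegrable hp).locallyIntegrableOn _)
    (fun g hg hgs hgt => by
      let φ : 𝓓((⊤ : Opens (Rn n)), ℝ) := ⟨g, hg, hgs, by simp⟩
      have hφ : ∀ x, φ x = g x := fun _ => rfl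
      have hint (f : Lp ℂ p (volume : Measure (Rn n))) : Integrable fun x => g x • f x :=
        ((Lp.memLp f).locallyIntegrable hp).integrable_smul_left_of_hasCompactSupport
          hg.continuous hgs
      have h' := h φ hgt
      simp only [regular_Lp_apply hp, hφ] at h'
      rw [← sub_eq_zero, ← integral_sub (hint w) (hint w')] at h'
      rw [← h']
      refine integral_congr_ae ?_
      filter_upwards [Lp.coeFn_sub w w'] with x hx
      rw [hx, Pi.sub_apply, smul_sub])
  filter_upwards [hae, Lp.coeFn_zero ℂ p (volume : Measure (Rn n)),
    compl_mem_ae_iff.2 (measure_singleton (μ := volume) (0 : Rn n))] with x hx h0 hx0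
  rw [hx hx0, h0]; rfl

/-- `bumpTest` and the `coordTest i` are, up to sign, dual to `δ₀` and the `Dᵢ δ₀`. -/
theorem comb_injective {c₀ d₀ : ℂ} {c d : Fin n → ℂ}
    (h : c₀ • dirac n + ∑ j, c j • diracD j = d₀ • dirac n + ∑ j, d j • diracD j) :
    c₀ = d₀ ∧ c = d := by
  constructor
  · have := DFunLike.congr_fun h (bumpTest n)
    simpa only [comb_apply, bumpTest_zero, fderiv_bumpTest, zero_apply,
      Complex.ofReal_zero, Complex.ofReal_one, mul_zero, mul_one, Finset.sum_const_zero,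
      sub_zero] using this
  · funext i
    have := DFunLike.congr_fun h (coordTest i)
    rw [comb_apply, comb_apply] at this
    simpa [coordTest_zero, fderiv_coordTest, Pi.single_apply, apply_ite Complex.ofReal] using this

/-- On test functions supported off the origin the Dirac terms vanish and the terms in `u` agree,
which forces `w = w'`. The other two cases follow by taking some coefficients zero. -/
theorem defect_representation_unique (hn : 1 ≤ n) {p : ℝ≥0∞} (hp : 1 ≤ p)
    {u : Lp ℂ p (volume.restrict (punctured n : Set (Rn n)))}
    {w w' : Lp ℂ p (volume : Measure (Rn n))} {c₀ d₀ : ℂ} {c d : Fin n → ℂ}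
    (hw : defect u w = d₀ • dirac n + ∑ j, d j • diracD j)
    (hw' : defect u w' = c₀ • dirac n + ∑ j, c j • diracD j) :
    w = w' ∧ d₀ = c₀ ∧ d = c := by
  have hww : w = w' := by
    refine ae_eq_of_regular_eq_off_zero hn hp fun φ hφ => ?_
    have h0 : (φ : Rn n → ℝ) =ᶠ[𝓝 0] fun _ => 0 :=
      notMem_tsupport_iff_eventuallyEq.1 (Set.subset_compl_singleton_iff.1 hφ)
    have h1 : fderiv ℝ φ 0 = 0 := by rw [h0.fderiv_eq]; simp
    have e := DFunLike.congr_fun hw φ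
    have e' := DFunLike.congr_fun hw' φ
    simp only [comb_apply, defect_apply, h0.eq_of_nhds, h1] at e e'
    simp only [zero_apply, Complex.ofReal_zero, mul_zero,
      Finset.sum_const_zero, sub_zero, neg_add_eq_zero] at e e'
    exact e.symm.trans e'
  subst hww
  exact ⟨rfl, comb_injective (hw.symm.trans hw')⟩

theorem natCast_le_of_critExp_le {k : ℕ} {p : ℝ≥0∞} (hp : 1 ≤ p) (hp_top : p ≠ ⊤)
    (h : critExp n k ≤ p) : (k : ℝ) ≤ n * (1 - 1 / p.toReal) := by
  unfold critExp at h
  split_ifs at h with hnk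
  · exact absurd (top_le_iff.1 h) hp_top
  push Not at hnk
  have hq : 1 ≤ p.toReal := by
    rw [← ENNReal.toReal_one]
    exact ENNReal.toReal_mono hp_top hp
  have h' := ENNReal.toReal_mono hp_top h
  rw [ENNReal.toReal_div, ENNReal.toReal_natCast, ENNReal.toReal_natCast, Nat.cast_sub hnk.le,
    div_le_iff₀ (by simpa using hnk)] at h'
  have : (n : ℝ) / p.toReal ≤ n - k := by
    rw [div_le_iff₀ (by linarith)]; linarith
  rw [mul_sub, mul_one_div]
  linarith

end Representation

end LaplaceSobolev

end

/-! ### The main theorem: the three cases are `k = 0, 1, 2`. -/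

open LaplaceSobolev in
theorem lemma3p3 (n : ℕ) (hn : 1 ≤ n) (p : ℝ≥0∞) (hp : 1 < p) (hp_top : p < ⊤)
    (u : Lp ℂ p (volume.restrict (punctured n : Set (Rn n))))
    (hu : u ∈ WDelta (punctured n) p)
    (v : Lp ℂ p (volume.restrict (punctured n : Set (Rn n))))
    (hv : LaplaceEq (punctured n) u v) :
    Distribution.dsupport (defect u (zeroExt v)) ⊆ {(0 : Rn n)} ∧
    (p < critExp n 1 →
      ∃ (c₀ : ℂ) (c : Fin n → ℂ),
        defect u (zeroExt v) = c₀ • dirac n + ∑ j, c j • diracD j ∧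
        ∀ (w : Lp ℂ p (volume : Measure (Rn n))) (d₀ : ℂ) (d : Fin n → ℂ),
          defect u w = d₀ • dirac n + ∑ j, d j • diracD j →
            w = zeroExt v ∧ d₀ = c₀ ∧ d = c) ∧
    (critExp n 1 ≤ p → p < critExp n 2 →
      ∃ c₀ : ℂ,
        defect u (zeroExt v) = c₀ • dirac n ∧
        ∀ (w : Lp ℂ p (volume : Measure (Rn n))) (d₀ : ℂ),
          defect u w = d₀ • dirac n → w = zeroExt v ∧ d₀ = c₀) ∧
    (critExp n 2 ≤ p →
      defect u (zeroExt v) = 0 ∧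
      ∀ w : Lp ℂ p (volume : Measure (Rn n)), defect u w = 0 → w = zeroExt v) := by
  have vanish {k : ℕ} := defect_eq_zero_of_vanishing_order hn hp.le hp_top.ne hv (k := k)
  have unique {w : Lp ℂ p (volume : Measure (Rn n))} {c₀ d₀ : ℂ} {c d : Fin n → ℂ} :=
    defect_representation_unique hn hp.le (u := u) (w := w) (w' := zeroExt v)
      (c₀ := c₀) (d₀ := d₀) (c := c) (d := d)
  refine ⟨?_, fun _ => ?_, fun h1 _ => ?_, fun h2 => ?_⟩
  · exact Set.sInter_subset_of_mem
      ⟨fun φ hφ => defect_eq_zero_of_tsupport hn hp.le hv φ hφ, isClosed_singleton⟩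
  · have hq : 1 ≤ p.toReal := by
      rw [← ENNReal.toReal_one]
      exact ENNReal.toReal_mono hp_top.ne hp.le
    have h0 : ((0 : ℕ) : ℝ) ≤ n * (1 - 1 / p.toReal) := by
      rw [Nat.cast_zero]
      refine mul_nonneg n.cast_nonneg ?_
      rw [sub_nonneg, div_le_one (by linarith)]
      exact hq
    have hT := eq_comb_of_vanishing fun φ hφ hφ' =>
      vanish (Nat.zero_le 2) h0 φ (fun _ => hφ) fun _ => hφ'
    exact ⟨_, _, hT, fun w d₀ d hw => unique hw hT⟩
  · have hT := eq_smul_dirac_of_vanishing fun φ hφ =>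
      vanish one_le_two (natCast_le_of_critExp_le hp.le hp_top.ne h1) φ (fun _ => hφ)
        (by simp)
    refine ⟨_, hT, fun w d₀ hw => ?_⟩
    have := unique (hw.trans (smul_dirac_eq_comb _)) (hT.trans (smul_dirac_eq_comb _))
    exact ⟨this.1, this.2.1⟩
  · have hT : defect u (zeroExt v) = 0 := by
      ext φ
      -- For `k = 2` no vanishing of `φ` is required.
      exact vanish le_rfl (natCast_le_of_critExp_le hp.le hp_top.ne h2) φ (by simp) (by simp)
    refine ⟨hT, fun w hw => ?_⟩
    have h0 : (0 : 𝓓'((⊤ : Opens (Rn n)), ℂ)) = (0 : ℂ) • dirac n := by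
      ext φ
      simp
    exact (unique (hw.trans (h0.trans (smul_dirac_eq_comb _)))
      (hT.trans (h0.trans (smul_dirac_eq_comb _)))).1
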